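/- Let $G$ be a finite group. A subgroup $H$ of $G$ is called $2$-maximal in $G$ if there is a subgroup $M$ of $G$ such that $M$ is a maximal subgroup of $G$ and $H$ is a maximal subgroup of $M$. A subgroup $H$ of $G$ is called an $IC\Phi$-subgroup of $G$ if $H \cap [H,G] \le \Phi(H)$, where $\Phi(H)$ denotes the Frattini subgroup of $H$, i.e. the intersection of all maximal subgroups of $H$ (with $\Phi(H) = H$ if $H$ is trivial). Suppose that $G$ has a non-trivial $2$-maximal subgroup and that every $2$-maximal subgroup of $G$ is an $IC\Phi$-subgroup of $G$. Then $G$ is nilpotent. -/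

import Mathlib

namespace FiniteGroup

variable {G : Type*} [Group G]

/-- `H` is a maximal subgroup of the subgroup `K` of `G`. -/
def IsMaximalIn (H K : Subgroup G) : Prop :=
  H ≤ K ∧ IsCoatom (H.subgroupOf K)

/-- `IsNMaximal n H`: there is a chain `G = H₀ > H₁ > ⋯ > Hₙ = H` of subgroups of `G` in which
each term is a maximal subgroup of the preceding one. -/
inductive IsNMaximal : ℕ → Subgroup G → Prop
  | zero : IsNMaximal 0 ⊤
  | succ {n : ℕ} {K H : Subgroup G} : IsNMaximal n K → IsMaximalIn H K → IsNMaximal (n + 1) H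

/-- `H` is an `ICΦ`-subgroup of `G`: `H ∩ [H, G] ≤ Φ(H)`, with the Frattini subgroup of `H`
regarded as a subgroup of `G`. -/
def IsICPhi (H : Subgroup G) : Prop :=
  H ⊓ ⁅H, (⊤ : Subgroup G)⁆ ≤ (frattini H).map H.subtype

end FiniteGroup

namespace FiniteGroup

open scoped commutatorElement

variable {G : Type*} [Group G]

theorem isMaximalIn_iff_covBy {H K : Subgroup G} : IsMaximalIn H K ↔ H ⋖ K := by
  constructor
  · rintro ⟨hle, hne, hmax⟩
    refine ⟨lt_of_le_of_ne hle fun h => hne (Subgroup.subgroupOf_eq_top.2 h.ge), ?_⟩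
    intro J hHJ hJK
    have hlt : H.subgroupOf K < J.subgroupOf K := by
      refine lt_of_le_of_ne (Subgroup.comap_mono hHJ.le) fun h => hHJ.ne ?_
      have := congrArg (Subgroup.map K.subtype) h
      simpa [Subgroup.subgroupOf_map_subtype, inf_eq_left.2 hle, inf_eq_left.2 hJK.le] using this
    exact hJK.not_ge (Subgroup.subgroupOf_eq_top.1 (hmax _ hlt))
  · intro h
    refine ⟨h.le, fun ht => h.lt.not_ge (Subgroup.subgroupOf_eq_top.1 ht), ?_⟩
    intro J hJ
    have hmap : J.map K.subtype = K := by
      have hle : H ≤ J.map K.subtype := by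
        have := Subgroup.map_mono (f := K.subtype) hJ.le
        rwa [Subgroup.subgroupOf_map_subtype, inf_eq_left.2 h.le] at this
      refine (h.eq_or_eq hle (Subgroup.map_subtype_le J)).resolve_left fun he => ?_
      apply hJ.ne
      rw [← he]
      exact Subgroup.comap_map_eq_self_of_injective K.subtype_injective J
    rw [eq_top_iff, ← Subgroup.map_le_map_iff_of_injective K.subtype_injective, hmap]
    exact Subgroup.map_subtype_le _

theorem mem_map_frattini_iff {H : Subgroup G} {x : G} :
    x ∈ (frattini H).map H.subtype ↔ x ∈ H ∧ ∀ L, L ⋖ H → x ∈ L := by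
  constructor
  · rintro ⟨y, hy, rfl⟩
    refine ⟨y.2, fun L hL => ?_⟩
    exact frattini_le_coatom (isMaximalIn_iff_covBy.2 hL).2 hy
  · rintro ⟨hx, h⟩
    refine ⟨⟨x, hx⟩, ?_, rfl⟩
    simp only [frattini, Order.radical, SetLike.mem_coe, Subgroup.mem_iInf]
    intro J hJ
    have hself : (J.map H.subtype).subgroupOf H = J :=
      Subgroup.comap_map_eq_self_of_injective H.subtype_injective J
    have hcov : J.map H.subtype ⋖ H :=
      isMaximalIn_iff_covBy.1 ⟨Subgroup.map_subtype_le J, hself.symm ▸ hJ⟩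
    rw [← hself]
    exact Subgroup.mem_subgroupOf.2 (h _ hcov)

theorem isICPhi_iff {H : Subgroup G} :
    IsICPhi H ↔ ∀ L, L ⋖ H → H ⊓ ⁅H, (⊤ : Subgroup G)⁆ ≤ L := by
  constructor
  · exact fun h L hL x hx => (mem_map_frattini_iff.1 (h hx)).2 L hL
  · exact fun h x hx => mem_map_frattini_iff.2 ⟨hx.1, fun L hL => h L hL hx⟩

theorem isNMaximal_two_iff {H : Subgroup G} :
    IsNMaximal 2 H ↔ ∃ M : Subgroup G, IsCoatom M ∧ H ⋖ M := by
  constructor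
  · rintro (_ | ⟨_ | ⟨_ | _, hM⟩, hH⟩)
    exact ⟨_, covBy_top_iff.1 (isMaximalIn_iff_covBy.1 hM), isMaximalIn_iff_covBy.1 hH⟩
  · rintro ⟨M, hM, hH⟩
    exact .succ (.succ .zero (isMaximalIn_iff_covBy.2 (covBy_top_iff.2 hM)))
      (isMaximalIn_iff_covBy.2 hH)

theorem normal_commutator_top (H : Subgroup G) : ⁅H, (⊤ : Subgroup G)⁆.Normal :=
  Subgroup.normalizer_eq_top_iff.1 (top_le_iff.1 (Subgroup.normalizer_commutator_ge_right ..))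

theorem commutator_top_le_iff {N R : Subgroup G} [R.Normal] :
    ⁅N, (⊤ : Subgroup G)⁆ ≤ R ↔ N ≤ (Subgroup.center (G ⧸ R)).comap (QuotientGroup.mk' R) := by
  have h : ⁅N, (⊤ : Subgroup G)⁆ ≤ R ↔
      ⁅N.map (QuotientGroup.mk' R), (⊤ : Subgroup (G ⧸ R))⁆ = ⊥ := by
    have ht : (⊤ : Subgroup G).map (QuotientGroup.mk' R) = ⊤ :=
      Subgroup.map_top_of_surjective _ (QuotientGroup.mk'_surjective R)
    rw [← ht, ← Subgroup.map_commutator, Subgroup.map_eq_bot_iff, QuotientGroup.ker_mk']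
  rw [h, Subgroup.commutator_top_right_eq_bot_iff_le_center, Subgroup.map_le_iff_le_comap]

theorem commutator_sup_top_le {A B R : Subgroup G} [R.Normal] (hA : ⁅A, (⊤ : Subgroup G)⁆ ≤ R)
    (hB : ⁅B, (⊤ : Subgroup G)⁆ ≤ R) : ⁅A ⊔ B, (⊤ : Subgroup G)⁆ ≤ R := by
  rw [commutator_top_le_iff] at *
  exact sup_le hA hB

theorem commutator_normalClosure_top_le (H : Subgroup G) :
    ⁅Subgroup.normalClosure (H : Set G), (⊤ : Subgroup G)⁆ ≤ ⁅H, (⊤ : Subgroup G)⁆ := by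
  have := normal_commutator_top H
  exact commutator_top_le_iff.2 (Subgroup.normalClosure_le_normal (commutator_top_le_iff.1 le_rfl))

theorem IsICPhi.eq_bot_of_le_commutator [Finite G] {H : Subgroup G} (h : IsICPhi H)
    (hle : H ≤ ⁅H, (⊤ : Subgroup G)⁆) : H = ⊥ := by
  by_contra hne
  obtain ⟨L, -, hL⟩ := exists_le_covBy_of_lt (bot_lt_iff_ne_bot.2 hne)
  exact hL.lt.not_ge ((le_inf le_rfl hle).trans (isICPhi_iff.1 h L hL))

theorem le_coatom_of_le_covBy [Finite G] {K N X : Subgroup G} [N.Normal] (hNK : N ≤ K)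
    (h : ∀ L, L ⋖ K → N ≤ L) (hX : IsCoatom X) : N ≤ X := by
  by_contra hN
  have hsup : X ⊔ N = ⊤ := hX.2 _ (left_lt_sup.2 hN)
  have hlt : K ⊓ X < K := inf_lt_left.2 fun hKX => hN (hNK.trans hKX)
  obtain ⟨L, hKL, hL⟩ := exists_le_covBy_of_lt hlt
  refine hL.lt.not_ge fun k hk => ?_
  have hkt : k ∈ X ⊔ N := hsup ▸ Subgroup.mem_top k
  obtain ⟨x, hx, n, hn, rfl⟩ := Subgroup.mem_sup_of_normal_right.1 hkt
  refine L.mul_mem (hKL ⟨?_, hx⟩) (h L hL hn)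
  exact (K.mul_mem_cancel_right (hNK hn)).1 hk

theorem IsICPhi.commutator_le_coatom [Finite G] {H X : Subgroup G} (h : IsICPhi H)
    (hH : H.Normal) (hX : IsCoatom X) : ⁅H, (⊤ : Subgroup G)⁆ ≤ X := by
  have := normal_commutator_top H
  have hle : ⁅H, (⊤ : Subgroup G)⁆ ≤ H := Subgroup.commutator_top_right_le_iff.2 hH
  exact le_coatom_of_le_covBy hle
    (fun L hL => (le_inf hle le_rfl).trans (isICPhi_iff.1 h L hL)) hX

theorem normal_coatom_of_commutator_le {N X : Subgroup G} (hX : IsCoatom X)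
    (h : ⁅N, (⊤ : Subgroup G)⁆ ≤ X) (hN : ¬ N ≤ X) : X.Normal := by
  have hnorm : N ≤ Subgroup.normalizer X :=
    Subgroup.le_normalizer_iff_commutator_le_right.2
      ((Subgroup.commutator_mono le_rfl le_top).trans h)
  refine Subgroup.normalizer_eq_top_iff.1 (hX.2 _ (lt_of_le_of_ne Subgroup.le_normalizer ?_))
  exact fun he => hN (hnorm.trans he.ge)

theorem isNilpotent_of_coatoms_normal [Finite G] (h : ∀ X : Subgroup G, IsCoatom X → X.Normal) :
    Group.IsNilpotent G :=
  ((Group.isNilpotent_of_finite_tfae (G := G)).out 0 2).2 h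

/-- A finite group is nilpotent as soon as it has a normal maximal subgroup `K` and a subgroup `H`
with `[K, G] ≤ H` and `[H, G] ≤ Φ(G)`. -/
theorem isNilpotent_of_commutator_le [Finite G] {K H : Subgroup G} (hK : IsCoatom K)
    (hKn : K.Normal) (hKH : ⁅K, (⊤ : Subgroup G)⁆ ≤ H)
    (hH : ∀ X : Subgroup G, IsCoatom X → ⁅H, (⊤ : Subgroup G)⁆ ≤ X) : Group.IsNilpotent G := by
  refine isNilpotent_of_coatoms_normal fun X hX => ?_
  by_cases hHX : H ≤ X
  · by_cases hKX : K ≤ X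
    · rwa [(hK.le_iff.1 hKX).resolve_left hX.1]
    · exact normal_coatom_of_commutator_le hX (hKH.trans hHX) hKX
  · exact normal_coatom_of_commutator_le hX (hH X hX) hHX

theorem exists_normal_coatom_of_commutator_ne_top [Finite G] (h : commutator G ≠ ⊤) :
    ∃ K : Subgroup G, IsCoatom K ∧ K.Normal := by
  obtain ⟨K, hK, hle⟩ := (eq_top_or_exists_le_coatom (commutator G)).resolve_left h
  exact ⟨K, hK, Subgroup.Normal.of_commutator_le G hle⟩

theorem IsICPhi.commutator_ne_top [Finite G] {H : Subgroup G} (h : IsICPhi H)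
    (hn : ¬ H.Normal) (hc : Subgroup.normalClosure (H : Set G) = ⊤) : commutator G ≠ ⊤ := by
  intro ht
  have hle := commutator_normalClosure_top_le H
  rw [hc, ← commutator_def, ht] at hle
  exact hn (h.eq_bot_of_le_commutator (le_top.trans hle) ▸ Subgroup.normal_bot)

theorem isNilpotent_of_coatoms_isICPhi [Finite G]
    (h : ∀ H : Subgroup G, IsCoatom H → IsICPhi H) : Group.IsNilpotent G := by
  by_cases hnorm : ∀ X : Subgroup G, IsCoatom X → X.Normal
  · exact isNilpotent_of_coatoms_normal hnorm
  push Not at hnorm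
  obtain ⟨H, hH, hn⟩ := hnorm
  have hc : Subgroup.normalClosure (H : Set G) = ⊤ := by
    refine (hH.le_iff.1 Subgroup.le_normalClosure).resolve_right fun he => hn ?_
    exact he ▸ Subgroup.normalClosure_normal
  obtain ⟨K, hK, hKn⟩ :=
    exists_normal_coatom_of_commutator_ne_top ((h H hH).commutator_ne_top hn hc)
  exact isNilpotent_of_commutator_le hK hKn (Subgroup.commutator_top_right_le_iff.2 hKn)
    fun X hX => (h K hK).commutator_le_coatom hKn hX

theorem isICPhi_of_isICPhi_map {M : Subgroup G} {H : Subgroup M}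
    (h : IsICPhi (H.map M.subtype)) : IsICPhi H := by
  intro x hx
  have hcomm : ⁅H, (⊤ : Subgroup M)⁆.map M.subtype ≤ ⁅H.map M.subtype, (⊤ : Subgroup G)⁆ := by
    rw [Subgroup.map_commutator]
    exact Subgroup.commutator_mono le_rfl le_top
  have hmem := h ⟨Subgroup.mem_map_of_mem M.subtype hx.1,
    hcomm (Subgroup.mem_map_of_mem M.subtype hx.2)⟩
  rw [mem_map_frattini_iff] at hmem ⊢
  refine ⟨hx.1, fun L hL => ?_⟩
  have hL' : L.map M.subtype ⋖ H.map M.subtype := by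
    refine ⟨(Subgroup.map_lt_map_iff_of_injective M.subtype_injective).2 hL.lt, ?_⟩
    intro J hLJ hJH
    have hJ : (J.subgroupOf M).map M.subtype = J := by
      rw [Subgroup.subgroupOf_map_subtype, inf_eq_left]
      exact hJH.le.trans (Subgroup.map_subtype_le H)
    rw [← hJ, Subgroup.map_lt_map_iff_of_injective M.subtype_injective] at hLJ hJH
    exact hL.2 hLJ hJH
  exact (Subgroup.mem_map_iff_mem M.subtype_injective).1 (hmem.2 _ hL')

theorem isNilpotent_coatom [Finite G]
    (hIC : ∀ M H : Subgroup G, IsCoatom M → H ⋖ M → IsICPhi H) {M : Subgroup G}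
    (hM : IsCoatom M) : Group.IsNilpotent M := by
  refine isNilpotent_of_coatoms_isICPhi fun H hH => isICPhi_of_isICPhi_map (hIC M _ hM ?_)
  refine isMaximalIn_iff_covBy.1 ⟨Subgroup.map_subtype_le H, ?_⟩
  have : (H.map M.subtype).subgroupOf M = H :=
    Subgroup.comap_map_eq_self_of_injective M.subtype_injective H
  rwa [this]

theorem zpowers_eq_of_unique_covBy [Finite G] {H M : Subgroup G} (hu : ∀ L, L ⋖ M → L = H) {x : G}
    (hx : x ∈ M) (hxH : x ∉ H) : Subgroup.zpowers x = M := by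
  by_contra hne
  obtain ⟨L, hxL, hL⟩ :=
    exists_le_covBy_of_lt (lt_of_le_of_ne (Subgroup.zpowers_le.2 hx) hne)
  exact hxH (hu L hL ▸ hxL (Subgroup.mem_zpowers x))

theorem exists_isPGroup_of_unique_covBy [Finite G] {H M : Subgroup G} (hH : H ⋖ M)
    (hu : ∀ L, L ⋖ M → L = H) : ∃ p : ℕ, p.Prime ∧ IsPGroup p M := by
  obtain ⟨x, hx, hxH⟩ := SetLike.exists_of_lt hH.lt
  have hz := zpowers_eq_of_unique_covBy hu hx hxH
  have hcard : orderOf x = Nat.card M := by rw [← hz, Nat.card_zpowers]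
  have hpow : ∀ p : ℕ, p.Prime → p ∣ orderOf x → x ^ p ∈ H := by
    intro p hp hpx
    by_contra hn
    have hz' := zpowers_eq_of_unique_covBy hu (M.pow_mem hx p) hn
    have h1 : orderOf (x ^ p) = orderOf x := by
      rw [hcard, ← hz', Nat.card_zpowers]
    rw [orderOf_pow_of_dvd hp.ne_zero hpx] at h1
    exact (Nat.div_lt_self (orderOf_pos x) hp.one_lt).ne h1
  have h1 : orderOf x ≠ 1 := fun h => hxH (orderOf_eq_one_iff.1 h ▸ H.one_mem)
  obtain ⟨p, hp, hpx⟩ := Nat.exists_prime_and_dvd h1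
  refine ⟨p, hp, IsPGroup.of_card (n := (orderOf x).primeFactorsList.length) ?_⟩
  rw [← hcard]
  refine Nat.eq_prime_pow_of_unique_prime_dvd (orderOf_pos x).ne' fun {q} hq hqx => ?_
  by_contra hqp
  have hcop : IsCoprime (q : ℤ) (p : ℤ) :=
    Nat.isCoprime_iff_coprime.2 ((Nat.coprime_primes hq hp).2 hqp)
  obtain ⟨a, b, hab⟩ := hcop
  apply hxH
  have : x = (x ^ q) ^ a * (x ^ p) ^ b := by
    rw [← zpow_natCast, ← zpow_natCast, ← zpow_mul, ← zpow_mul, ← zpow_add, mul_comm (q : ℤ),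
      mul_comm (p : ℤ), hab, zpow_one]
  rw [this]
  exact H.mul_mem (H.zpow_mem (hpow q hq hqx) a) (H.zpow_mem (hpow p hp hpx) b)

/-- By Burnside's transfer theorem, a finite group with a non-normal maximal subgroup having
exactly one maximal subgroup is not perfect. -/
theorem commutator_ne_top_of_unique_covBy [Finite G] {H M : Subgroup G} (hM : IsCoatom M)
    (hn : ¬ M.Normal) (hH : H ⋖ M) (hu : ∀ L, L ⋖ M → L = H) : commutator G ≠ ⊤ := by
  intro ht
  obtain ⟨p, hp, hpM⟩ := exists_isPGroup_of_unique_covBy hH hu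
  have := Fact.mk hp
  obtain ⟨P, hMP⟩ := hpM.exists_le_sylow
  rcases hM.le_iff.1 hMP with hP | hP
  · have hnil : Group.IsNilpotent G := by
      refine IsPGroup.isNilpotent (p := p) ?_
      have := P.isPGroup'
      rw [hP] at this
      exact this.of_equiv Subgroup.topEquiv
    exact hn (Subgroup.NormalizerCondition.normal_of_coatom M
      Group.normalizerCondition_of_isNilpotent hM)
  · obtain ⟨x, hx, hxH⟩ := SetLike.exists_of_lt hH.lt
    have hz := zpowers_eq_of_unique_covBy hu hx hxH
    have hnorm : Subgroup.normalizer (M : Set G) = M := by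
      refine (hM.le_iff.1 Subgroup.le_normalizer).resolve_left fun he => hn ?_
      exact Subgroup.normalizer_eq_top_iff.1 he
    have hNC : Subgroup.normalizer ((P : Subgroup G) : Set G) ≤
        Subgroup.centralizer ((P : Subgroup G) : Set G) := by
      rw [hP, hnorm, ← hz]
      exact Subgroup.le_centralizer _
    have hcompl := MonoidHom.ker_transferSylow_isComplement' P hNC
    have hker : (MonoidHom.transferSylow P hNC).ker = ⊤ := by
      rw [eq_top_iff, ← ht, commutator_def, Subgroup.commutator_le]
      intro a _ b _
      have hcomm : ∀ u v : P, u * v = v * u := fun u v =>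
        Subtype.ext (hNC (Subgroup.le_normalizer v.2) u u.2)
      rw [MonoidHom.mem_ker, map_commutatorElement, commutatorElement_eq_one_iff_mul_comm]
      exact hcomm _ _
    rw [hker, Subgroup.isComplement'_top_left, hP] at hcompl
    exact hn (hcompl ▸ Subgroup.normal_bot)

theorem commutator_ne_top_of_isICPhi [Finite G]
    (hIC : ∀ M H : Subgroup G, IsCoatom M → H ⋖ M → IsICPhi H) {M : Subgroup G}
    (hM : IsCoatom M) (hn : ¬ M.Normal) : commutator G ≠ ⊤ := by
  by_cases hall : ∀ H, H ⋖ M → H.Normal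
  · have hM0 : M ≠ ⊥ := fun h => hn (h ▸ Subgroup.normal_bot)
    obtain ⟨H, -, hH⟩ := exists_le_covBy_of_lt (bot_lt_iff_ne_bot.2 hM0)
    refine commutator_ne_top_of_unique_covBy hM hn hH fun L hL => ?_
    by_contra hne
    have := hall H hH
    have := hall L hL
    exact hn (hL.wcovBy.sup_eq hH.wcovBy hne ▸ Subgroup.sup_normal L H)
  · push Not at hall
    obtain ⟨H, hH, hHn⟩ := hall
    by_cases hc : Subgroup.normalClosure (H : Set G) = ⊤
    · exact (hIC M H hM hH).commutator_ne_top hHn hc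
    set N := Subgroup.normalClosure (H : Set G)
    have hNn : N.Normal := Subgroup.normalClosure_normal
    have hNM : ¬ N ≤ M := fun h => by
      rcases hH.eq_or_eq Subgroup.le_normalClosure h with he | he
      · exact hHn (he ▸ hNn)
      · exact hn (he ▸ hNn)
    have hsup : M ⊔ N = ⊤ := hM.2 _ (left_lt_sup.2 hNM)
    obtain ⟨X, hX, hNX⟩ := (eq_top_or_exists_le_coatom N).resolve_left hc
    have := isNilpotent_coatom hIC hX
    have := isNilpotent_coatom hIC hM
    have hsN : Group.IsSolvable N :=
      Group.isSolvable_of_isSolvable_injective (Subgroup.inclusion_injective hNX)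
    have hsQ : Group.IsSolvable (G ⧸ N) := by
      refine Group.isSolvable_of_surjective (f := (QuotientGroup.mk' N).comp M.subtype) fun q => ?_
      obtain ⟨g, rfl⟩ := QuotientGroup.mk'_surjective N q
      have hg : g ∈ M ⊔ N := hsup ▸ Subgroup.mem_top g
      obtain ⟨m, hm, n, hn, rfl⟩ := Subgroup.mem_sup_of_normal_right.1 hg
      refine ⟨⟨m, hm⟩, ?_⟩
      simp [(QuotientGroup.eq_one_iff n).2 hn]
    have hs : Group.IsSolvable G :=
      Group.isSolvable_of_ker_le_range N.subtype (QuotientGroup.mk' N) (by simp)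
    have : Nontrivial G := by
      by_contra h
      rw [not_nontrivial_iff_subsingleton] at h
      exact hM.1 (Subsingleton.elim _ _)
    exact (Group.IsSolvable.commutator_lt_top_of_nontrivial G).ne

/-- In a cyclic normal subgroup `K` with exactly one maximal subgroup `H`, conjugation by `G` acts
on `K` and on `H` by the same powers. -/
theorem commutator_le_of_unique_covBy [Finite G] {H K : Subgroup G} (hK : K.Normal)
    (hHn : H.Normal) (hHK : H ≤ K) (hu : ∀ L, L ⋖ K → L = H) (hIC : IsICPhi H) (hH : H ≠ ⊥) :
    ⁅K, (⊤ : Subgroup G)⁆ ≤ H := by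
  rw [Subgroup.commutator_le]
  intro x hx g _
  by_contra hy
  have hxH : x ∉ H := fun h => hy <| Subgroup.commutator_top_right_le_iff.2 hHn
    (Subgroup.commutator_mem_commutator h (Subgroup.mem_top g))
  have hyK : ⁅x, g⁆ ∈ K := Subgroup.commutator_top_right_le_iff.2 hK
    (Subgroup.commutator_mem_commutator hx (Subgroup.mem_top g))
  have hzx := zpowers_eq_of_unique_covBy hu hx hxH
  have hzy := zpowers_eq_of_unique_covBy hu hyK hy
  obtain ⟨b, hb⟩ := Subgroup.mem_zpowers_iff.1 (hzx.symm ▸ hyK)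
  obtain ⟨c, hc⟩ := Subgroup.mem_zpowers_iff.1 (hzy.symm ▸ hx)
  refine hH (hIC.eq_bot_of_le_commutator fun h hh => ?_)
  obtain ⟨m, rfl⟩ := Subgroup.mem_zpowers_iff.1 (hzx.symm ▸ hHK hh)
  have hconj : g * x⁻¹ * g⁻¹ = x ^ (b - 1) := by
    rw [zpow_sub_one, hb, commutatorElement_def]
    have hcom : Commute x ⁅x, g⁆ := hb ▸ (Commute.refl x).zpow_right b
    rw [← commutatorElement_def, ← (hcom.inv_left).eq, commutatorElement_def]
    group
  have hcm : ⁅x ^ m, g⁆ = x ^ (b * m) := by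
    have : ⁅x ^ m, g⁆ = x ^ m * (g * x⁻¹ * g⁻¹) ^ m := by
      rw [conj_zpow, commutatorElement_def, inv_zpow, mul_assoc, mul_assoc, mul_assoc]
    rw [this, hconj, ← zpow_mul, ← zpow_add]
    congr 1
    ring
  have hxm : x ^ m = ⁅x ^ m, g⁆ ^ c := by
    rw [hcm, ← zpow_mul, mul_right_comm, zpow_mul, zpow_mul, hb, hc]
  rw [hxm]
  exact Subgroup.zpow_mem _
    (Subgroup.commutator_mem_commutator hh (Subgroup.mem_top g)) c

/-- If `1 < K < G` is an unrefinable chain with `K` normal, then all proper subgroups of maximal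
subgroups other than `K` are trivial. -/
theorem eq_bot_of_covBy_coatom {K M H : Subgroup G} (hK : IsCoatom K) (hKn : K.Normal)
    (hKbot : ⊥ ⋖ K) (hM : IsCoatom M) (hMK : M ≠ K) (hH : H ⋖ M) : H = ⊥ := by
  have hKM : ¬ K ≤ M := fun h => (hK.le_iff.1 h).elim hM.1 hMK
  have hinf : K ⊓ M = ⊥ :=
    (hKbot.eq_or_eq bot_le inf_le_left).resolve_right fun h => hKM (inf_eq_left.1 h)
  rcases hK.le_iff.1 (le_sup_right : K ≤ H ⊔ K) with hs | hs
  · refine absurd (fun m hm => ?_) hH.lt.not_ge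
    have hmt : m ∈ H ⊔ K := hs ▸ Subgroup.mem_top m
    obtain ⟨h, hh, k, hk, rfl⟩ := Subgroup.mem_sup_of_normal_right.1 hmt
    have hk1 : k ∈ K ⊓ M := ⟨hk, (M.mul_mem_cancel_left (hH.le hh)).1 hm⟩
    rw [hinf, Subgroup.mem_bot] at hk1
    simpa [hk1] using hh
  · exact eq_bot_iff.2 (hinf ▸ le_inf (sup_eq_right.1 hs) hH.le)

theorem isNilpotent_of_normal_coatom [Finite G]
    (hne : ∃ M H : Subgroup G, IsCoatom M ∧ H ⋖ M ∧ H ≠ ⊥)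
    (hIC : ∀ M H : Subgroup G, IsCoatom M → H ⋖ M → IsICPhi H) {K : Subgroup G}
    (hK : IsCoatom K) (hKn : K.Normal) : Group.IsNilpotent G := by
  have hKK : ⁅K, (⊤ : Subgroup G)⁆ ≤ K := Subgroup.commutator_top_right_le_iff.2 hKn
  by_cases hall : ∀ H, H ⋖ K → H.Normal
  · by_cases hK0 : K = ⊥
    · exact isNilpotent_of_commutator_le hK hKn hKK fun X _ => by
        rw [hK0, Subgroup.commutator_bot_left]
        exact bot_le
    obtain ⟨H, -, hH⟩ := exists_le_covBy_of_lt (bot_lt_iff_ne_bot.2 hK0)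
    have hHn := hall H hH
    by_cases hu : ∀ L, L ⋖ K → L = H
    · by_cases hH0 : H = ⊥
      · obtain ⟨M₀, H₀, hM₀, hH₀, h0⟩ := hne
        refine absurd ?_ h0
        by_cases hMK : M₀ = K
        · rw [← hH0]
          exact hu H₀ (hMK ▸ hH₀)
        · exact eq_bot_of_covBy_coatom hK hKn (hH0 ▸ hH) hM₀ hMK hH₀
      · have hICH := hIC K H hK hH
        exact isNilpotent_of_commutator_le hK hKn
          (commutator_le_of_unique_covBy hKn hHn hH.le hu hICH hH0)
          fun X hX => hICH.commutator_le_coatom hHn hX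
    · push Not at hu
      obtain ⟨L, hL, hLH⟩ := hu
      have := normal_commutator_top L
      have := normal_commutator_top H
      refine isNilpotent_of_commutator_le hK hKn hKK fun X hX => ?_
      rw [← hL.wcovBy.sup_eq hH.wcovBy hLH]
      exact (commutator_sup_top_le le_sup_left le_sup_right).trans
        (sup_le ((hIC K L hK hL).commutator_le_coatom (hall L hL) hX)
          ((hIC K H hK hH).commutator_le_coatom hHn hX))
  · push Not at hall
    obtain ⟨H, hH, hHn⟩ := hall
    have hc : Subgroup.normalClosure (H : Set G) = K := by
      refine (hH.eq_or_eq Subgroup.le_normalClosure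
        (Subgroup.normalClosure_le_normal hH.le)).resolve_left fun he => hHn ?_
      exact he ▸ Subgroup.normalClosure_normal
    have hKH : ⁅K, (⊤ : Subgroup G)⁆ ≤ ⁅H, (⊤ : Subgroup G)⁆ := by
      simpa only [hc] using commutator_normalClosure_top_le H
    have hlt : ⁅H, (⊤ : Subgroup G)⁆ < K := by
      refine lt_of_le_of_ne ((Subgroup.commutator_mono hH.le le_rfl).trans hKK) fun he => hHn ?_
      rw [(hIC K H hK hH).eq_bot_of_le_commutator (hH.le.trans he.ge)]
      exact Subgroup.normal_bot
    obtain ⟨L, hHL, hL⟩ := exists_le_covBy_of_lt hlt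
    have hLn : L.Normal := Subgroup.commutator_top_right_le_iff.1
      ((Subgroup.commutator_mono hL.le le_rfl).trans (hKH.trans hHL))
    exact isNilpotent_of_commutator_le hK hKn (hKH.trans hHL)
      fun X hX => (hIC K L hK hL).commutator_le_coatom hLn hX

end FiniteGroup

theorem theorem1p8 {G : Type*} [Group G] [Finite G]
    (hne : ∃ H : Subgroup G, FiniteGroup.IsNMaximal 2 H ∧ H ≠ ⊥)
    (hIC : ∀ H : Subgroup G, FiniteGroup.IsNMaximal 2 H → FiniteGroup.IsICPhi H) :
    Group.IsNilpotent G := by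
  have hIC' : ∀ M H : Subgroup G, IsCoatom M → H ⋖ M → FiniteGroup.IsICPhi H :=
    fun M H hM hH => hIC H (FiniteGroup.isNMaximal_two_iff.2 ⟨M, hM, hH⟩)
  obtain ⟨H, hH, hH0⟩ := hne
  obtain ⟨M, hM, hHM⟩ := FiniteGroup.isNMaximal_two_iff.1 hH
  by_cases hnorm : ∀ X : Subgroup G, IsCoatom X → X.Normal
  · exact FiniteGroup.isNilpotent_of_coatoms_normal hnorm
  push Not at hnorm
  obtain ⟨X, hX, hXn⟩ := hnorm
  obtain ⟨K, hK, hKn⟩ := FiniteGroup.exists_normal_coatom_of_commutator_ne_top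
    (FiniteGroup.commutator_ne_top_of_isICPhi hIC' hX hXn)
  exact FiniteGroup.isNilpotent_of_normal_coatom ⟨M, H, hM, hHM, hH0⟩ hIC' hK hKn
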